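/- Let $p\ge 0$ and let $M$ be a finite-dimensional smooth (Hausdorff) manifold. For $k\ge 0$ and $n\ge 0$, two smooth maps $\phi,\phi':\mathbb R^n\to M$ have the same $k$-jet at the origin if, for every smooth $f:M\to\mathbb R$, the functions $f\circ\phi$ and $f\circ\phi'$ have the same partial derivatives of all orders $\le k$ (order $0$ included) at $0$; the class of $\phi$ is written $j^k\phi$ and the set of classes $J^k_nM$. The set $J^1_pM$ is a smooth manifold: a chart $x$ of $M$ induces the chart $j^1\phi\mapsto\bigl(x(\phi(0)),\,D(x\circ\phi)(0)\bigr)$. It is a smooth vector bundle over $M$ with projection $\pi_M(j^1\phi)=\phi(0)$, the operations on a fibre being those on the derivatives $D(x\circ\phi)(0)$. The double jet manifold $J^1_p(J^1_pM)$ carries two structures over $J^1_pM$: (1) the primary structure, that of the $1$-jet bundle of the manifold $J^1_pM$, with projection $\tilde\pi(j^1\Phi)=\Phi(0)$; (2) the secondary structure, with projection $\pi^1_M(j^1\Phi)=j^1(\pi_M\circ\Phi)$ and with the fibrewise operations that add and multiply by scalars the pair $\bigl(F(0),DF(0)\bigr)$, where $F=\mathrm{pr}_2\circ\psi\circ\Phi$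 is the fibre component of $\Phi$ in the local trivialization $\psi(j^1\phi)=\bigl(\phi(0),D(x\circ\phi)(0)\bigr)$ of $J^1_pM$ given by a chart $x$ of $M$. Let $\Lambda:J^2_{2p}M\to J^1_p(J^1_pM)$ be the map that sends $j^2\phi$, for $\phi:\mathbb R^p\times\mathbb R^p\to M$, to the $1$-jet at $0$ of $u\mapsto j^1\bigl(w\mapsto\phi(u,w)\bigr)$, and let $\hat\ell(j^2\phi)=j^2(\phi\circ\mathfrak f)$, where $\mathfrak f(u,w)=(w,u)$. Then both structures are smooth vector bundles over $J^1_pM$; there is exactly one map $\ell:J^1_p(J^1_pM)\to J^1_p(J^1_pM)$ with $\ell\circ\Lambda=\Lambda\circ\hat\ell$; this map $\ell$ (the canonical involution) satisfies $\ell\circ\ell=\mathrm{id}$; and $\ell$ is an isomorphism of vector bundles over the identity of $J^1_pM$ from the primary structure to the secondary structure: $\ell$ is a diffeomorphism, $\pi^1_M\circ\ell=\tilde\pi$, and $\ell$ is linear from each fibre of $\tilde\pi$ to the fibre of $\pi^1_M$ over the same point. In particular the two vector bundle structures on $J^1_p(J^1_pM)$ are isomorphic. -/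

import Mathlib

open scoped Manifold ContDiff Topology
open Set Filter

noncomputable section

set_option linter.unusedSectionVars false

/-! ### Jets -/

section Jets

variable (k : ℕ) (V : Type*) [NormedAddCommGroup V] [NormedSpace ℝ V]
  (E : Type*) [NormedAddCommGroup E] [NormedSpace ℝ E]
  (M : Type*) [TopologicalSpace M] [ChartedSpace E M]

/-- Two smooth maps `φ, ξ : V → M` have the same `k`-jet at the origin: for every smooth
`f : M → ℝ`, the functions `f ∘ φ` and `f ∘ ξ` have the same value and the same derivatives of
all orders `≤ k` at `0`. -/
def jetSetoid : Setoid C^∞⟮𝓘(ℝ, V), V; 𝓘(ℝ, E), M⟯ where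
  r φ ξ := ∀ f : C^∞⟮𝓘(ℝ, E), M; 𝓘(ℝ, ℝ), ℝ⟯, ∀ i ≤ k,
    iteratedFDeriv ℝ i (fun u => f (φ u)) 0 = iteratedFDeriv ℝ i (fun u => f (ξ u)) 0
  iseqv :=
    { refl := fun _ _ _ _ => rfl
      symm := fun h f i hi => (h f i hi).symm
      trans := fun h h' f i hi => (h f i hi).trans (h' f i hi) }

/-- The set of `k`-jets at the origin of smooth maps `V → M`, where `M` is modelled on `E`. -/
def Jet : Type _ := Quotient (jetSetoid k V E M)

variable {k V E M}

/-- The `k`-jet at the origin of a smooth map `V → M`. -/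
def Jet.mk (φ : C^∞⟮𝓘(ℝ, V), V; 𝓘(ℝ, E), M⟯) : Jet k V E M :=
  Quotient.mk (jetSetoid k V E M) φ

variable (k) in
/-- The map of jets induced by a smooth map `h : M → N`: the jet of `φ` goes to that of `h ∘ φ`. -/
def Jet.map {E' : Type*} [NormedAddCommGroup E'] [NormedSpace ℝ E']
    {N : Type*} [TopologicalSpace N] [ChartedSpace E' N]
    (h : C^∞⟮𝓘(ℝ, E), M; 𝓘(ℝ, E'), N⟯) : Jet k V E M → Jet k V E' N :=
  Quotient.map (sa := jetSetoid k V E M) (sb := jetSetoid k V E' N) (fun φ => h.comp φ)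
    (fun _ _ hr f i hi => hr (f.comp h) i hi)

/-- A representative of a jet. -/
def Jet.rep (j : Jet k V E M) : C^∞⟮𝓘(ℝ, V), V; 𝓘(ℝ, E), M⟯ :=
  Quotient.out (s := jetSetoid k V E M) j

theorem Jet.mk_rep (j : Jet k V E M) : Jet.mk j.rep = j :=
  Quotient.out_eq (s := jetSetoid k V E M) j

theorem Jet.mk_eq_mk {φ ξ : C^∞⟮𝓘(ℝ, V), V; 𝓘(ℝ, E), M⟯} :
    (Jet.mk φ : Jet k V E M) = Jet.mk ξ ↔ (jetSetoid k V E M) φ ξ :=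
  Quotient.eq (r := jetSetoid k V E M)

theorem contDiffAt_chart_comp [IsManifold 𝓘(ℝ, E) ∞ M] {e : OpenPartialHomeomorph M E}
    (he : e ∈ IsManifold.maximalAtlas 𝓘(ℝ, E) ∞ M) {φ : V → M} {u : V}
    (hφ : ContMDiffAt 𝓘(ℝ, V) 𝓘(ℝ, E) ∞ φ u) (hu : φ u ∈ e.source) :
    ContDiffAt ℝ ∞ (fun v => e (φ v)) u :=
  ((contMDiffAt_of_mem_maximalAtlas he hu).comp u hφ).contDiffAt

theorem fderiv_eq_of_iteratedFDeriv_one {F : Type*} [NormedAddCommGroup F] [NormedSpace ℝ F]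
    {f g : V → F} {u : V} (h : iteratedFDeriv ℝ 1 f u = iteratedFDeriv ℝ 1 g u) :
    fderiv ℝ f u = fderiv ℝ g u := by
  ext v
  simpa [iteratedFDeriv_one_apply] using congrArg (fun T => T (fun _ => v)) h


theorem fderiv_fderiv_eq_of_iteratedFDeriv_two {F : Type*} [NormedAddCommGroup F]
    [NormedSpace ℝ F] {f g : V → F} {u : V} (h : iteratedFDeriv ℝ 2 f u = iteratedFDeriv ℝ 2 g u) :
    fderiv ℝ (fderiv ℝ f) u = fderiv ℝ (fderiv ℝ g) u := by
  ext v w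
  simpa [iteratedFDeriv_two_apply] using congrArg (fun T => T ![v, w]) h

variable [FiniteDimensional ℝ E] [T2Space M]

theorem exists_smooth_eq_near [IsManifold 𝓘(ℝ, E) ∞ M] {e : OpenPartialHomeomorph M E}
    (he : e ∈ IsManifold.maximalAtlas 𝓘(ℝ, E) ∞ M) {x : M} (hx : x ∈ e.source) (g : E →L[ℝ] ℝ) :
    ∃ f : C^∞⟮𝓘(ℝ, E), M; 𝓘(ℝ, ℝ), ℝ⟯, ∀ᶠ y in 𝓝 x, f y = g (e y) := by
  obtain ⟨b, -, hb⟩ := ((SmoothBumpFunction.nhds_basis_tsupport (I := 𝓘(ℝ, E)) x).mem_iff).1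
    (e.open_source.mem_nhds hx)
  have hs : ContMDiff 𝓘(ℝ, E) 𝓘(ℝ, ℝ) ∞ (fun y => b y * g (e y)) := by
    intro y
    by_cases hy : y ∈ e.source
    · exact (b.contMDiffAt).mul (g.contDiff.contMDiff.contMDiffAt.comp y
        (contMDiffAt_of_mem_maximalAtlas he hy))
    · have hy' : y ∉ tsupport b := fun h => hy (hb h)
      have h0 : ContMDiffAt 𝓘(ℝ, E) 𝓘(ℝ, ℝ) ∞ (fun _ : M => (0 : ℝ)) y := contMDiffAt_const
      refine h0.congr_of_eventuallyEq ?_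
      filter_upwards [(isClosed_tsupport b).isOpen_compl.mem_nhds hy'] with z hz
      rw [image_eq_zero_of_notMem_tsupport hz, zero_mul]
  refine ⟨⟨_, hs⟩, ?_⟩
  filter_upwards [b.eventuallyEq_one] with y hy
  simp [hy]

theorem jetSetoid.apply_zero [IsManifold 𝓘(ℝ, E) ∞ M] {φ ξ : C^∞⟮𝓘(ℝ, V), V; 𝓘(ℝ, E), M⟯}
    (h : jetSetoid k V E M φ ξ) : φ 0 = ξ 0 := by
  by_contra hne
  obtain ⟨b, -, hb⟩ := ((SmoothBumpFunction.nhds_basis_tsupport (I := 𝓘(ℝ, E)) (φ 0)).mem_iff).1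
    (isOpen_compl_singleton.mem_nhds hne)
  have h0 := h ⟨b, b.contMDiff⟩ 0 (Nat.zero_le _)
  have h1 : b (φ 0) = b (ξ 0) := by
    have := congrArg (fun T => T 0) h0
    simpa using this
  rw [b.eq_one, image_eq_zero_of_notMem_tsupport (fun hm => hb hm rfl)] at h1
  exact one_ne_zero h1

/-- Maps with the same `k`-jet have the same derivatives of order `≤ k` in every chart. -/
theorem jetSetoid.iteratedFDeriv_eq [IsManifold 𝓘(ℝ, E) ∞ M] {e : OpenPartialHomeomorph M E}
    (he : e ∈ IsManifold.maximalAtlas 𝓘(ℝ, E) ∞ M) {φ ξ : C^∞⟮𝓘(ℝ, V), V; 𝓘(ℝ, E), M⟯}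
    (h : jetSetoid k V E M φ ξ) (hφ : φ 0 ∈ e.source) {i : ℕ} (hi : i ≤ k) :
    iteratedFDeriv ℝ i (fun u => e (φ u)) 0 = iteratedFDeriv ℝ i (fun u => e (ξ u)) 0 := by
  have h0 := jetSetoid.apply_zero h
  have hξ : ξ 0 ∈ e.source := h0 ▸ hφ
  ext m
  refine (SeparatingDual.eq_iff_forall_dual_eq (R := ℝ)).2 fun g => ?_
  obtain ⟨f, hf⟩ := exists_smooth_eq_near he hφ g
  have key : ∀ ψ : C^∞⟮𝓘(ℝ, V), V; 𝓘(ℝ, E), M⟯, ψ 0 = φ 0 →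
      iteratedFDeriv ℝ i (fun u => f (ψ u)) 0 m = g (iteratedFDeriv ℝ i (fun u => e (ψ u)) 0 m) := by
    intro ψ hψ
    have hev : (fun u => f (ψ u)) =ᶠ[𝓝 0] (g ∘ fun u => e (ψ u)) := by
      have := ψ.contMDiff.continuous.continuousAt (x := (0 : V))
      rw [ContinuousAt, hψ] at this
      exact this.eventually hf
    rw [(Filter.EventuallyEq.iteratedFDeriv ℝ hev i).eq_of_nhds, g.iteratedFDeriv_comp_left (n := ∞)
      (contDiffAt_chart_comp he ψ.contMDiff.contMDiffAt (hψ ▸ hφ)) (by exact_mod_cast le_top)]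
    rfl
  rw [← key φ rfl, ← key ξ h0.symm, h f i hi]


theorem jetSetoid.fderiv_eq [IsManifold 𝓘(ℝ, E) ∞ M] {e : OpenPartialHomeomorph M E}
    (he : e ∈ IsManifold.maximalAtlas 𝓘(ℝ, E) ∞ M) {φ ξ : C^∞⟮𝓘(ℝ, V), V; 𝓘(ℝ, E), M⟯}
    (h : jetSetoid 1 V E M φ ξ) (hφ : φ 0 ∈ e.source) :
    fderiv ℝ (fun u => e (φ u)) 0 = fderiv ℝ (fun u => e (ξ u)) 0 :=
  fderiv_eq_of_iteratedFDeriv_one (jetSetoid.iteratedFDeriv_eq he h hφ le_rfl)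

/-- Maps with the same value and the same first derivative in one chart have the same `1`-jet. -/
theorem jetSetoid.of_chart [IsManifold 𝓘(ℝ, E) ∞ M] {e : OpenPartialHomeomorph M E}
    (he : e ∈ IsManifold.maximalAtlas 𝓘(ℝ, E) ∞ M) {φ ξ : C^∞⟮𝓘(ℝ, V), V; 𝓘(ℝ, E), M⟯}
    (hφ : φ 0 ∈ e.source) (h0 : φ 0 = ξ 0)
    (h1 : fderiv ℝ (fun u => e (φ u)) 0 = fderiv ℝ (fun u => e (ξ u)) 0) :
    jetSetoid 1 V E M φ ξ := by
  intro f i hi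
  have hf : ContDiffAt ℝ ∞ (fun y => f (e.symm y)) (e (φ 0)) :=
    (f.contMDiff.contMDiffAt.comp _
      (contMDiffAt_symm_of_mem_maximalAtlas he (e.map_source hφ))).contDiffAt
  have key : ∀ ψ : C^∞⟮𝓘(ℝ, V), V; 𝓘(ℝ, E), M⟯, ψ 0 = φ 0 →
      fderiv ℝ (fun u => f (ψ u)) 0 =
        (fderiv ℝ (fun y => f (e.symm y)) (e (φ 0))).comp (fderiv ℝ (fun u => e (ψ u)) 0) := by
    intro ψ hψ
    have hev : (fun u => f (ψ u)) =ᶠ[𝓝 0] ((fun y => f (e.symm y)) ∘ fun u => e (ψ u)) := by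
      have := ψ.contMDiff.continuous.continuousAt (x := (0 : V))
      rw [ContinuousAt, hψ] at this
      filter_upwards [this.eventually (e.open_source.mem_nhds hφ)] with u hu
      simp [e.left_inv hu]
    have hd : DifferentiableAt ℝ (fun u => e (ψ u)) 0 :=
      (contDiffAt_chart_comp he ψ.contMDiff.contMDiffAt (hψ ▸ hφ)).differentiableAt (by simp)
    rw [hev.fderiv_eq, fderiv_comp 0 _ hd, hψ]
    rw [hψ]
    exact hf.differentiableAt (by simp)
  interval_cases i
  · ext m
    simp [h0]
  · ext m
    rw [iteratedFDeriv_one_apply, iteratedFDeriv_one_apply, key φ rfl, key ξ h0.symm, h1]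

variable [FiniteDimensional ℝ V]

/-- Every germ at the origin read in a chart is the germ of a globally defined smooth map. -/
theorem exists_smooth_germ {E M : Type*} [NormedAddCommGroup E] [NormedSpace ℝ E]
    [TopologicalSpace M] [ChartedSpace E M] [IsManifold 𝓘(ℝ, E) ∞ M]
    {e : OpenPartialHomeomorph M E}
    (he : e ∈ IsManifold.maximalAtlas 𝓘(ℝ, E) ∞ M) {g : V → E} (hg : ContDiff ℝ ∞ g)
    (h0 : g 0 ∈ e.target) :
    ∃ φ : C^∞⟮𝓘(ℝ, V), V; 𝓘(ℝ, E), M⟯, ∀ᶠ u in 𝓝 (0 : V), φ u = e.symm (g u) := by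
  obtain ⟨δ, hδ, hball⟩ := Metric.mem_nhds_iff.1
    (hg.continuous.continuousAt.preimage_mem_nhds (e.open_target.mem_nhds h0))
  let b : ContDiffBump (0 : V) := ⟨δ / 3, δ / 2, by positivity, by linarith⟩
  have hmem : ∀ u, g (b u • u) ∈ e.target := by
    intro u
    apply hball
    rw [Metric.mem_ball, dist_zero_right, norm_smul, Real.norm_of_nonneg b.nonneg]
    by_cases hu : dist u 0 < δ / 2
    · rw [dist_zero_right] at hu
      nlinarith [b.le_one (x := u), norm_nonneg u, b.nonneg (x := u)]
    · rw [b.zero_of_le_dist (not_lt.1 hu), zero_mul]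
      exact hδ
  have hs : ContDiff ℝ ∞ (fun u => g (b u • u)) := hg.comp (b.contDiff.smul contDiff_id)
  refine ⟨⟨fun u => e.symm (g (b u • u)), fun u => ?_⟩, ?_⟩
  · exact (contMDiffAt_symm_of_mem_maximalAtlas he (hmem u)).comp u hs.contMDiff.contMDiffAt
  · filter_upwards [b.eventuallyEq_one] with u hu
    have hu' : b u = 1 := hu
    change e.symm (g (b u • u)) = e.symm (g u)
    rw [hu', one_smul]

section Charts

variable [IsManifold 𝓘(ℝ, E) ∞ M]

/-- The target of a jet: the jet of `φ` goes to `φ 0`. -/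
def Jet.proj : Jet k V E M → M :=
  Quotient.lift (s := jetSetoid k V E M) (fun φ => φ 0) fun _ _ h => jetSetoid.apply_zero h

theorem Jet.proj_mk (φ : C^∞⟮𝓘(ℝ, V), V; 𝓘(ℝ, E), M⟯) : (Jet.mk φ : Jet k V E M).proj = φ 0 := rfl

theorem Jet.rep_zero (j : Jet k V E M) : j.rep 0 = j.proj := by
  rw [← Jet.proj_mk (k := k), Jet.mk_rep]

/-- The derivative at the origin of a `1`-jet in a chart. -/
def Jet.deriv (e : OpenPartialHomeomorph M E) (j : Jet 1 V E M) : V →L[ℝ] E :=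
  fderiv ℝ (fun u => e (j.rep u)) 0

theorem Jet.deriv_mk {e : OpenPartialHomeomorph M E}
    (he : e ∈ IsManifold.maximalAtlas 𝓘(ℝ, E) ∞ M) {φ : C^∞⟮𝓘(ℝ, V), V; 𝓘(ℝ, E), M⟯}
    (hφ : φ 0 ∈ e.source) :
    (Jet.mk φ : Jet 1 V E M).deriv e = fderiv ℝ (fun u => e (φ u)) 0 := by
  have h : jetSetoid 1 V E M φ (Jet.mk φ : Jet 1 V E M).rep :=
    Jet.mk_eq_mk.1 (Jet.mk_rep _).symm
  exact (jetSetoid.fderiv_eq he h hφ).symm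

theorem Jet.ext_chart {e : OpenPartialHomeomorph M E}
    (he : e ∈ IsManifold.maximalAtlas 𝓘(ℝ, E) ∞ M) {j j' : Jet 1 V E M}
    (hj : j.proj ∈ e.source) (h0 : j.proj = j'.proj) (h1 : j.deriv e = j'.deriv e) : j = j' := by
  rw [← j.mk_rep, ← j'.mk_rep, Jet.mk_eq_mk]
  exact jetSetoid.of_chart he (j.rep_zero ▸ hj) (by rw [j.rep_zero, j'.rep_zero, h0]) h1

/-- A smooth map with prescribed value and derivative in a chart. -/
def affineGerm (e : OpenPartialHomeomorph M E)
    (he : e ∈ IsManifold.maximalAtlas 𝓘(ℝ, E) ∞ M) (z : E × (V →L[ℝ] E)) :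
    C^∞⟮𝓘(ℝ, V), V; 𝓘(ℝ, E), M⟯ :=
  open Classical in
  if h : z.1 + z.2 0 ∈ e.target then
    (exists_smooth_germ (V := V) he (g := fun u => z.1 + z.2 u)
      (contDiff_const.add z.2.contDiff) h).choose
  else ContMDiffMap.const (e.symm z.1)

theorem affineGerm_eventually {e : OpenPartialHomeomorph M E}
    (he : e ∈ IsManifold.maximalAtlas 𝓘(ℝ, E) ∞ M) {z : E × (V →L[ℝ] E)} (hz : z.1 ∈ e.target) :
    ∀ᶠ u in 𝓝 (0 : V), affineGerm e he z u = e.symm (z.1 + z.2 u) := by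
  have h : z.1 + z.2 0 ∈ e.target := by simpa using hz
  rw [affineGerm, dif_pos h]
  exact (exists_smooth_germ (V := V) he (g := fun u => z.1 + z.2 u)
      (contDiff_const.add z.2.contDiff) h).choose_spec

theorem affineGerm_zero {e : OpenPartialHomeomorph M E}
    (he : e ∈ IsManifold.maximalAtlas 𝓘(ℝ, E) ∞ M) {z : E × (V →L[ℝ] E)} (hz : z.1 ∈ e.target) :
    affineGerm e he z 0 = e.symm z.1 := by
  simpa using (affineGerm_eventually he hz).self_of_nhds

theorem fderiv_affineGerm {e e' : OpenPartialHomeomorph M E}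
    (he : e ∈ IsManifold.maximalAtlas 𝓘(ℝ, E) ∞ M)
    (he' : e' ∈ IsManifold.maximalAtlas 𝓘(ℝ, E) ∞ M) {z : E × (V →L[ℝ] E)} (hz : z.1 ∈ e.target)
    (hz' : e.symm z.1 ∈ e'.source) :
    fderiv ℝ (fun u => e' (affineGerm e he z u)) 0 =
      (fderiv ℝ (fun y => e' (e.symm y)) z.1).comp z.2 := by
  have hev : (fun u => e' (affineGerm e he z u)) =ᶠ[𝓝 0]
      ((fun y => e' (e.symm y)) ∘ fun u => z.1 + z.2 u) := by
    filter_upwards [affineGerm_eventually he hz] with u hu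
    simp [hu]
  have hd : DifferentiableAt ℝ (fun y => e' (e.symm y)) z.1 :=
    (contDiffAt_chart_comp he' (contMDiffAt_symm_of_mem_maximalAtlas he hz) hz').differentiableAt
      (by simp)
  rw [hev.fderiv_eq, fderiv_comp 0 (by simpa using hd) (by fun_prop)]
  simp

theorem fderiv_affineGerm_self {e : OpenPartialHomeomorph M E}
    (he : e ∈ IsManifold.maximalAtlas 𝓘(ℝ, E) ∞ M) {z : E × (V →L[ℝ] E)} (hz : z.1 ∈ e.target) :
    fderiv ℝ (fun u => e (affineGerm e he z u)) 0 = z.2 := by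
  rw [fderiv_affineGerm he he hz (e.map_target hz)]
  have : (fun y => e (e.symm y)) =ᶠ[𝓝 z.1] id := by
    filter_upwards [e.open_target.mem_nhds hz] with y hy using e.right_inv hy
  rw [this.fderiv_eq]
  simp

/-- The chart of the set of `1`-jets induced by a chart `e` of `M`: the jet of `φ` goes to the
value and the derivative of `e ∘ φ` at the origin. -/
def jetChart (e : OpenPartialHomeomorph M E)
    (he : e ∈ IsManifold.maximalAtlas 𝓘(ℝ, E) ∞ M) :
    PartialEquiv (Jet 1 V E M) (E × (V →L[ℝ] E)) where
  toFun j := (e j.proj, j.deriv e)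
  invFun z := Jet.mk (affineGerm e he z)
  source := {j | j.proj ∈ e.source}
  target := {z | z.1 ∈ e.target}
  map_source' _ hj := e.map_source hj
  map_target' z hz := by
    change affineGerm e he z 0 ∈ e.source
    rw [affineGerm_zero he hz]
    exact e.map_target hz
  left_inv' j hj := by
    have hz : (e j.proj, j.deriv e).1 ∈ e.target := e.map_source hj
    have h0 : affineGerm e he (e j.proj, j.deriv e) 0 = j.proj := by
      rw [affineGerm_zero he hz]
      exact e.left_inv hj
    refine Jet.ext_chart he ?_ h0 ?_
    · rw [Jet.proj_mk, h0]
      exact hj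
    · rw [Jet.deriv_mk he (by rw [h0]; exact hj), fderiv_affineGerm_self he hz]
  right_inv' z hz := by
    have hz' : z.1 ∈ e.target := hz
    have h0 := affineGerm_zero he hz'
    refine Prod.ext ?_ ?_
    · change e (affineGerm e he z 0) = z.1
      rw [h0, e.right_inv hz']
    · change (Jet.mk (affineGerm e he z) : Jet 1 V E M).deriv e = z.2
      rw [Jet.deriv_mk he (by rw [h0]; exact e.map_target hz'), fderiv_affineGerm_self he hz']

theorem jetChart_trans_source {e e' : OpenPartialHomeomorph M E}
    (he : e ∈ IsManifold.maximalAtlas 𝓘(ℝ, E) ∞ M)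
    (he' : e' ∈ IsManifold.maximalAtlas 𝓘(ℝ, E) ∞ M) :
    ((jetChart (V := V) e he).symm.trans (jetChart e' he')).source =
      (e.symm.trans e').source ×ˢ univ := by
  ext z
  rw [PartialEquiv.trans_source, OpenPartialHomeomorph.trans_source]
  change (z.1 ∈ e.target ∧ affineGerm e he z 0 ∈ e'.source) ↔
    (z.1 ∈ e.target ∧ e.symm z.1 ∈ e'.source) ∧ True
  rw [and_true]
  refine and_congr_right fun hz => ?_
  rw [affineGerm_zero he hz]

theorem jetChart_trans_contDiffOn {e e' : OpenPartialHomeomorph M E}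
    (he : e ∈ IsManifold.maximalAtlas 𝓘(ℝ, E) ∞ M)
    (he' : e' ∈ IsManifold.maximalAtlas 𝓘(ℝ, E) ∞ M) :
    ContDiffOn ℝ ∞ ((jetChart (V := V) e he).symm.trans (jetChart e' he'))
      ((e.symm.trans e').source ×ˢ univ) := by
  have h : ∀ z ∈ (e.symm.trans e').source ×ˢ (univ : Set (V →L[ℝ] E)),
      ((jetChart (V := V) e he).symm.trans (jetChart e' he')) z =
        (e' (e.symm z.1), (fderiv ℝ (fun y => e' (e.symm y)) z.1).comp z.2) := by
    rintro z ⟨hz, -⟩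
    rw [OpenPartialHomeomorph.trans_source] at hz
    have h0 := affineGerm_zero (V := V) he (z := z) hz.1
    refine Prod.ext ?_ ?_
    · change e' (affineGerm e he z 0) = _
      rw [h0]
    · change (Jet.mk (affineGerm e he z) : Jet 1 V E M).deriv e' = _
      rw [Jet.deriv_mk he' (by rw [h0]; exact hz.2), fderiv_affineGerm he he' hz.1 hz.2]
  refine ContDiffOn.congr ?_ h
  rintro z ⟨hz, -⟩
  rw [OpenPartialHomeomorph.trans_source] at hz
  have hd : ContDiffAt ℝ ∞ (fun y => e' (e.symm y)) z.1 :=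
    contDiffAt_chart_comp he' (contMDiffAt_symm_of_mem_maximalAtlas he hz.1) hz.2
  have hd' : ContDiffAt ℝ ∞ (fderiv ℝ (fun y => e' (e.symm y))) z.1 :=
    hd.fderiv_right (by exact_mod_cast le_rfl)
  exact ((hd.comp z contDiffAt_fst).prodMk
    ((hd'.comp z contDiffAt_fst).clm_comp contDiffAt_snd)).contDiffWithinAt

variable (V E M) in
/-- The charts of the set of `1`-jets. -/
def jetCore : ChartedSpaceCore (E × (V →L[ℝ] E)) (Jet 1 V E M) where
  atlas := {c | ∃ (e : OpenPartialHomeomorph M E) (h : e ∈ atlas E M),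
    c = jetChart e (IsManifold.subset_maximalAtlas h)}
  chartAt j := jetChart (chartAt E j.proj) (IsManifold.chart_mem_maximalAtlas j.proj)
  mem_chart_source j := mem_chart_source E j.proj
  chart_mem_atlas j := ⟨_, chart_mem_atlas E j.proj, rfl⟩
  open_source := by
    rintro _ _ ⟨e, he, rfl⟩ ⟨e', he', rfl⟩
    rw [jetChart_trans_source]
    exact (e.symm.trans e').open_source.prod isOpen_univ
  continuousOn_toFun := by
    rintro _ _ ⟨e, he, rfl⟩ ⟨e', he', rfl⟩
    rw [jetChart_trans_source]
    exact (jetChart_trans_contDiffOn _ _).continuousOn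

instance : TopologicalSpace (Jet 1 V E M) := (jetCore V E M).toTopologicalSpace

instance : ChartedSpace (E × (V →L[ℝ] E)) (Jet 1 V E M) := (jetCore V E M).toChartedSpace

instance : IsManifold 𝓘(ℝ, E × (V →L[ℝ] E)) ∞ (Jet 1 V E M) := by
  refine isManifold_of_contDiffOn _ _ _ ?_
  intro c c' hc hc'
  have hc1 : c ∈ ⋃ (e) (he : e ∈ (jetCore V E M).atlas),
    {(jetCore V E M).openPartialHomeomorph e he} := hc
  have hc2 : c' ∈ ⋃ (e) (he : e ∈ (jetCore V E M).atlas),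
    {(jetCore V E M).openPartialHomeomorph e he} := hc'
  simp only [mem_iUnion, mem_singleton_iff] at hc1 hc2
  obtain ⟨_, ⟨e, he, rfl⟩, rfl⟩ := hc1
  obtain ⟨_, ⟨e', he', rfl⟩, rfl⟩ := hc2
  have := jetChart_trans_contDiffOn (V := V) (IsManifold.subset_maximalAtlas (n := ∞)
    (I := 𝓘(ℝ, E)) he) (IsManifold.subset_maximalAtlas (n := ∞) (I := 𝓘(ℝ, E)) he')
  rw [← jetChart_trans_source] at this
  simp only [modelWithCornersSelf_coe, modelWithCornersSelf_coe_symm, Function.id_comp,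
    Function.comp_id, preimage_id, range_id, inter_univ]
  exact this

theorem Jet.chartAt_apply (j j' : Jet 1 V E M) :
    chartAt (E × (V →L[ℝ] E)) j j' =
      (chartAt E j.proj j'.proj, j'.deriv (chartAt E j.proj)) := rfl

theorem Jet.mem_chartAt_source (j j' : Jet 1 V E M) :
    j' ∈ (chartAt (E × (V →L[ℝ] E)) j).source ↔ j'.proj ∈ (chartAt E j.proj).source := Iff.rfl

theorem Jet.contMDiff_proj :
    ContMDiff 𝓘(ℝ, E × (V →L[ℝ] E)) 𝓘(ℝ, E) ∞ (Jet.proj : Jet 1 V E M → M) := by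
  intro j
  have h1 : ContMDiffAt 𝓘(ℝ, E × (V →L[ℝ] E)) 𝓘(ℝ, E) ∞
      (fun j' => ((chartAt (E × (V →L[ℝ] E)) j) j').1) j :=
    (contDiff_fst.contMDiff.contMDiffAt (n := ∞)).comp j
      (contMDiffAt_of_mem_maximalAtlas (IsManifold.chart_mem_maximalAtlas j)
        (mem_chart_source _ j))
  have h2 := (contMDiffAt_symm_of_mem_maximalAtlas (n := ∞) (I := 𝓘(ℝ, E))
    (IsManifold.chart_mem_maximalAtlas j.proj)
    ((chartAt E j.proj).map_source (mem_chart_source E j.proj))).comp j h1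
  refine h2.congr_of_eventuallyEq ?_
  filter_upwards [(chartAt (E × (V →L[ℝ] E)) j).open_source.mem_nhds (mem_chart_source _ j)]
    with j' hj'
  exact ((chartAt E j.proj).left_inv ((Jet.mem_chartAt_source j j').1 hj')).symm

instance : T2Space (Jet 1 V E M) := by
  refine ⟨fun j j' hne => ?_⟩
  by_cases h : j.proj = j'.proj
  · set c := chartAt (E × (V →L[ℝ] E)) j with hc
    have hj : j ∈ c.source := mem_chart_source _ j
    have hj' : j' ∈ c.source := by
      rw [hc, Jet.mem_chartAt_source, ← h]
      exact mem_chart_source E j.proj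
    obtain ⟨u, v, hu, hv, hju, hjv, huv⟩ := t2_separation (c.injOn.ne hj hj' hne)
    exact ⟨c.source ∩ c ⁻¹' u, c.source ∩ c ⁻¹' v, c.isOpen_inter_preimage hu,
      c.isOpen_inter_preimage hv, ⟨hj, hju⟩, ⟨hj', hjv⟩,
      (huv.preimage c).mono inter_subset_right inter_subset_right⟩
  · exact separated_by_continuous Jet.contMDiff_proj.continuous h

end Charts

end Jets


/-! ### Vector bundles -/

/-- A projection `T → B` together with a real vector space structure on each of its fibres. -/
structure FibrewiseVectorSpace (T B : Type*) where
  /-- The projection. -/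
  proj : T → B
  /-- The addition on the fibres. -/
  addCommGroup : ∀ b, AddCommGroup {v : T // proj v = b}
  /-- The multiplication by scalars on the fibres. -/
  module : ∀ b, Module ℝ {v : T // proj v = b}

namespace FibrewiseVectorSpace

/-- The fibre over a point of the base. -/
def Fibre {T B : Type*} (S : FibrewiseVectorSpace T B) (b : B) : Type _ := {v : T // S.proj v = b}

instance {T B : Type*} (S : FibrewiseVectorSpace T B) (b : B) : AddCommGroup (S.Fibre b) :=
  S.addCommGroup b

instance {T B : Type*} (S : FibrewiseVectorSpace T B) (b : B) : Module ℝ (S.Fibre b) :=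
  S.module b

variable {EB : Type*} [NormedAddCommGroup EB] [NormedSpace ℝ EB]
  {B : Type*} [TopologicalSpace B] [ChartedSpace EB B]
  {ET : Type*} [NormedAddCommGroup ET] [NormedSpace ℝ ET]
  {T : Type*} [TopologicalSpace T] [ChartedSpace ET T]
  {ET' : Type*} [NormedAddCommGroup ET'] [NormedSpace ℝ ET']
  {T' : Type*} [TopologicalSpace T'] [ChartedSpace ET' T']

/-- `S` is a smooth vector bundle with typical fibre `F`: around every point of the base there is a
local trivialization which is a diffeomorphism and is linear on each fibre. -/
def IsSmoothVectorBundle (S : FibrewiseVectorSpace T B)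
    (F : Type*) [NormedAddCommGroup F] [NormedSpace ℝ F] : Prop :=
  ∀ b : B, ∃ e : Bundle.Trivialization F S.proj, b ∈ e.baseSet ∧
    ContMDiffOn 𝓘(ℝ, ET) (𝓘(ℝ, EB).prod 𝓘(ℝ, F)) ∞ e e.source ∧
    ContMDiffOn (𝓘(ℝ, EB).prod 𝓘(ℝ, F)) 𝓘(ℝ, ET) ∞ e.toOpenPartialHomeomorph.symm e.target ∧
    ∀ b' ∈ e.baseSet, IsLinearMap ℝ (fun v : S.Fibre b' => (e v.1).2)

/-- `ℓ : T → T'` is an isomorphism of vector bundles over the identity of the common base `B`: a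
diffeomorphism of the total spaces, compatible with the projections, and linear on each fibre. -/
structure IsIso (S : FibrewiseVectorSpace T B) (S' : FibrewiseVectorSpace T' B) (ℓ : T → T') :
    Prop where
  proj_comp : ∀ v, S'.proj (ℓ v) = S.proj v
  diffeomorph : ∃ d : Diffeomorph 𝓘(ℝ, ET) 𝓘(ℝ, ET') T T' ∞, ⇑d = ℓ
  linear : ∀ b, IsLinearMap ℝ (M := S.Fibre b) (M₂ := S'.Fibre b)
    (fun v => ⟨ℓ v.1, (proj_comp v.1).trans v.2⟩)

end FibrewiseVectorSpace

/-! ### The two structures on the double jet bundle -/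

section DoubleJets

variable (V E M : Type*) [NormedAddCommGroup V] [NormedSpace ℝ V] [FiniteDimensional ℝ V]
  [NormedAddCommGroup E] [NormedSpace ℝ E] [FiniteDimensional ℝ E]
  [TopologicalSpace M] [T2Space M] [ChartedSpace E M] [IsManifold 𝓘(ℝ, E) ∞ M]

variable {E M} in
/-- The fibre of the `1`-jets over `x` is identified with `V →L[ℝ] E` by taking the derivative at
the origin in the preferred chart at `x`; another chart at `x` changes the identification by a
linear automorphism only, so that the vector space structure it induces does not depend on it. -/
def jetFibreEquiv (x : M) : {j : Jet 1 V E M // j.proj = x} ≃ (V →L[ℝ] E) where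
  toFun j := j.1.deriv (chartAt E x)
  invFun A := ⟨(jetChart (chartAt E x) (IsManifold.chart_mem_maximalAtlas x)).symm
      (chartAt E x x, A), by
    refine (affineGerm_zero (V := V) (e := chartAt E x) (z := (chartAt E x x, A))
      (IsManifold.chart_mem_maximalAtlas x) ?_).trans ?_
    · exact (chartAt E x).map_source (mem_chart_source E x)
    · exact (chartAt E x).left_inv (mem_chart_source E x)⟩
  left_inv := by
    rintro ⟨j, rfl⟩
    exact Subtype.ext ((jetChart (chartAt E j.proj)
      (IsManifold.chart_mem_maximalAtlas j.proj)).left_inv (mem_chart_source E j.proj))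
  right_inv A := congrArg Prod.snd ((jetChart (V := V) (chartAt E x)
      (IsManifold.chart_mem_maximalAtlas x)).right_inv (x := (chartAt E x x, A))
      ((chartAt E x).map_source (mem_chart_source E x)))

/-- The bundle of `1`-jets over `M`: the projection is `j¹φ ↦ φ 0`, and the operations on a fibre
are those of the derivatives at the origin in a chart, `[x; X] + [x; X'] = [x; X + X']` and
`λ [x; X] = [x; λ X]`. -/
def jetBundle : FibrewiseVectorSpace (Jet 1 V E M) M where
  proj := Jet.proj
  addCommGroup x := (jetFibreEquiv (E := E) V x).addCommGroup
  module x :=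
    letI := (jetFibreEquiv (E := E) V x).addCommGroup
    (jetFibreEquiv (E := E) V x).module ℝ

/-- The model space of the manifold of `1`-jets. -/
abbrev JetModel : Type _ := E × (V →L[ℝ] E)

/-- The double jets: the `1`-jets in the manifold of `1`-jets in `M`. -/
abbrev DoubleJet : Type _ := Jet 1 V (JetModel V E) (Jet 1 V E M)

/-- The primary structure on the double jets: that of the bundle of `1`-jets over the manifold
of `1`-jets in `M`. -/
def primaryBundle : FibrewiseVectorSpace (DoubleJet V E M) (Jet 1 V E M) :=
  jetBundle V (JetModel V E) (Jet 1 V E M)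

/-- The projection of the bundle of `1`-jets, as a smooth map. -/
def jetProj : C^∞⟮𝓘(ℝ, JetModel V E), Jet 1 V E M; 𝓘(ℝ, E), M⟯ :=
  ⟨Jet.proj, Jet.contMDiff_proj⟩

/-- The map of double jets into jets induced by the projection of the bundle of `1`-jets. -/
def secondaryProj : DoubleJet V E M → Jet 1 V E M := Jet.map 1 (jetProj V E M)

variable {V E M}

theorem proj_secondaryProj (j : DoubleJet V E M) : (secondaryProj V E M j).proj = j.proj.proj := by
  rw [← j.mk_rep]
  rfl

theorem deriv_secondaryProj (x : Jet 1 V E M) (j : DoubleJet V E M)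
    (hj : j.proj.proj ∈ (chartAt E x.proj).source) :
    (secondaryProj V E M j).deriv (chartAt E x.proj) =
      (ContinuousLinearMap.fst ℝ E (V →L[ℝ] E)).comp (j.deriv (chartAt (JetModel V E) x)) := by
  obtain ⟨Φ, rfl⟩ : ∃ Φ, Jet.mk Φ = j := ⟨_, j.mk_rep⟩
  have hΦ : Φ 0 ∈ (chartAt (JetModel V E) x).source := hj
  have hc : chartAt (JetModel V E) x ∈
      IsManifold.maximalAtlas 𝓘(ℝ, JetModel V E) ∞ (Jet 1 V E M) :=
    IsManifold.chart_mem_maximalAtlas x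
  have hd : DifferentiableAt ℝ (fun u => chartAt (JetModel V E) x (Φ u)) 0 :=
    (contDiffAt_chart_comp hc Φ.contMDiff.contMDiffAt hΦ).differentiableAt (by simp)
  rw [Jet.deriv_mk hc hΦ]
  have h1 : (secondaryProj V E M (Jet.mk Φ)).deriv (chartAt E x.proj) =
      fderiv ℝ (fun u => chartAt E x.proj ((Φ u).proj)) 0 :=
    Jet.deriv_mk (φ := (jetProj V E M).comp Φ) (IsManifold.chart_mem_maximalAtlas x.proj) hj
  rw [h1]
  exact (ContinuousLinearMap.fst ℝ E (V →L[ℝ] E)).hasFDerivAt.comp 0 hd.hasFDerivAt |>.fderiv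

variable (V E M) in
/-- The fibre of the secondary projection over a jet `θ` at `x` is identified with
`(V →L[ℝ] E) × (V →L[ℝ] (V →L[ℝ] E))`. In the local trivialization `ψ` of the bundle of `1`-jets
given by the preferred chart at `x`, the double jet of `Φ` goes to the value and the derivative at
the origin of the fibre component of `ψ ∘ Φ`. -/
def secondaryFibreEquiv (θ : Jet 1 V E M) :
    {j : DoubleJet V E M // secondaryProj V E M j = θ} ≃
      (V →L[ℝ] E) × (V →L[ℝ] (V →L[ℝ] E)) where
  toFun j := ((chartAt (JetModel V E) θ j.1.proj).2,
    (ContinuousLinearMap.snd ℝ E (V →L[ℝ] E)).comp (j.1.deriv (chartAt (JetModel V E) θ)))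
  invFun z := ⟨(jetChart (chartAt (JetModel V E) θ) (IsManifold.chart_mem_maximalAtlas θ)).symm
      ((chartAt E θ.proj θ.proj, z.1), (θ.deriv (chartAt E θ.proj)).prod z.2), by
    set c := jetChart (V := V) (chartAt (JetModel V E) θ) (IsManifold.chart_mem_maximalAtlas θ)
      with hc
    set w : JetModel V (JetModel V E) :=
      ((chartAt E θ.proj θ.proj, z.1), (θ.deriv (chartAt E θ.proj)).prod z.2) with hw
    have hwt : w ∈ c.target := (chartAt E θ.proj).map_source (mem_chart_source E θ.proj)
    have hs : (c.symm w).proj.proj ∈ (chartAt E θ.proj).source := c.map_target hwt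
    have hr : c (c.symm w) = w := c.right_inv hwt
    have h1 : (secondaryProj V E M (c.symm w)).proj = θ.proj := by
      rw [proj_secondaryProj]
      exact (chartAt E θ.proj).injOn hs (mem_chart_source E θ.proj)
        (congrArg (fun y => y.1.1) hr)
    refine Jet.ext_chart (e := chartAt E θ.proj) (IsManifold.chart_mem_maximalAtlas θ.proj)
      (by rw [h1]; exact mem_chart_source E θ.proj) h1 ?_
    rw [deriv_secondaryProj θ _ hs, show (c.symm w).deriv (chartAt (JetModel V E) θ) = w.2 from
      congrArg Prod.snd hr]
    ext v
    rfl⟩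
  left_inv := by
    rintro ⟨j, rfl⟩
    set θ := secondaryProj V E M j with hθ
    have hp : θ.proj = j.proj.proj := proj_secondaryProj j
    have hs : j.proj.proj ∈ (chartAt E θ.proj).source := hp ▸ mem_chart_source E θ.proj
    refine Subtype.ext (Eq.trans (congrArg (jetChart (chartAt (JetModel V E) θ)
      (IsManifold.chart_mem_maximalAtlas θ)).symm ?_) ((jetChart (chartAt (JetModel V E) θ)
      (IsManifold.chart_mem_maximalAtlas θ)).left_inv (x := j) hs))
    refine Prod.ext (Prod.ext ?_ rfl) ?_
    · change chartAt E θ.proj θ.proj = chartAt E θ.proj j.proj.proj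
      rw [← hp]
    · change (θ.deriv (chartAt E θ.proj)).prod _ = j.deriv (chartAt (JetModel V E) θ)
      rw [show θ.deriv (chartAt E θ.proj) = _ from deriv_secondaryProj θ j hs]
      ext v <;> rfl
  right_inv z := by
    have hr := (jetChart (V := V) (chartAt (JetModel V E) θ)
      (IsManifold.chart_mem_maximalAtlas θ)).right_inv
      (x := ((chartAt E θ.proj θ.proj, z.1), (θ.deriv (chartAt E θ.proj)).prod z.2))
      ((chartAt E θ.proj).map_source (mem_chart_source E θ.proj))
    refine Prod.ext (congrArg (fun y => y.1.2) hr) ?_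
    refine (congrArg (fun y => (ContinuousLinearMap.snd ℝ E (V →L[ℝ] E)).comp y.2) hr).trans ?_
    ext v
    rfl

variable (V E M)

/-- The secondary structure on the double jets: the projection is the map induced by that of the
bundle of `1`-jets, and the operations on the fibre over `[x; X]` are
`[x, X; y, Y] + [x, X; y', Y'] = [x, X; y + y', Y + Y']` and
`λ [x, X; y, Y] = [x, X; λ y, λ Y]`. -/
def secondaryBundle : FibrewiseVectorSpace (DoubleJet V E M) (Jet 1 V E M) where
  proj := secondaryProj V E M
  addCommGroup θ := (secondaryFibreEquiv V E M θ).addCommGroup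
  module θ :=
    letI := (secondaryFibreEquiv V E M θ).addCommGroup
    (secondaryFibreEquiv V E M θ).module ℝ

/-! ### Second order jets -/

variable {V E M}

/-- The partial map `w ↦ φ (u, w)`. -/
def slice (φ : C^∞⟮𝓘(ℝ, V × V), V × V; 𝓘(ℝ, E), M⟯) (u : V) : C^∞⟮𝓘(ℝ, V), V; 𝓘(ℝ, E), M⟯ :=
  φ.comp ⟨fun w => (u, w), (contDiff_prodMk_right u).contMDiff⟩

theorem deriv_slice_eventuallyEq {e : OpenPartialHomeomorph M E}
    (he : e ∈ IsManifold.maximalAtlas 𝓘(ℝ, E) ∞ M)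
    (φ : C^∞⟮𝓘(ℝ, V × V), V × V; 𝓘(ℝ, E), M⟯) {u : V} (hu : φ (u, 0) ∈ e.source) :
    (fun u' => (Jet.mk (slice φ u') : Jet 1 V E M).deriv e) =ᶠ[𝓝 u]
      (fun u' => (fderiv ℝ (fun y => e (φ y)) (u', 0)).comp (ContinuousLinearMap.inr ℝ V V)) := by
  have hc : Continuous (fun u' : V => φ (u', 0)) :=
    φ.contMDiff.continuous.comp (by fun_prop)
  filter_upwards [hc.continuousAt.eventually (e.open_source.mem_nhds hu)] with u' hu'
  rw [Jet.deriv_mk he hu']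
  have hd : DifferentiableAt ℝ (fun y => e (φ y)) (u', 0) :=
    (contDiffAt_chart_comp he φ.contMDiff.contMDiffAt hu').differentiableAt (by simp)
  exact (hd.hasFDerivAt.comp (0 : V) (hasFDerivAt_prodMk_right u' 0)).fderiv

/-- The map `u ↦ j¹(w ↦ φ (u, w))`. -/
def prolong (φ : C^∞⟮𝓘(ℝ, V × V), V × V; 𝓘(ℝ, E), M⟯) :
    C^∞⟮𝓘(ℝ, V), V; 𝓘(ℝ, JetModel V E), Jet 1 V E M⟯ :=
  ⟨fun u => Jet.mk (slice φ u), by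
    intro u
    set e := chartAt E (φ (u, 0)) with he'
    have he : e ∈ IsManifold.maximalAtlas 𝓘(ℝ, E) ∞ M := IsManifold.chart_mem_maximalAtlas _
    have hu : φ (u, 0) ∈ e.source := mem_chart_source E _
    set c := chartAt (JetModel V E) (Jet.mk (slice φ u) : Jet 1 V E M) with hc'
    have hc : c ∈ IsManifold.maximalAtlas 𝓘(ℝ, JetModel V E) ∞ (Jet 1 V E M) :=
      IsManifold.chart_mem_maximalAtlas _
    have hd : ContDiffAt ℝ ∞ (fun y => e (φ y)) (u, 0) :=
      contDiffAt_chart_comp he φ.contMDiff.contMDiffAt hu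
    have hd' : ContDiffAt ℝ ∞ (fderiv ℝ (fun y => e (φ y))) (u, 0) :=
      hd.fderiv_right (by exact_mod_cast le_rfl)
    have hi : ContDiffAt ℝ ∞ (fun u' : V => (u', (0 : V))) u := by fun_prop
    have h1 : ContDiffAt ℝ ∞ (fun u' => c (Jet.mk (slice φ u'))) u := by
      refine ContDiffAt.congr_of_eventuallyEq (f := fun u' => (e (φ (u', 0)),
        (fderiv ℝ (fun y => e (φ y)) (u', 0)).comp (ContinuousLinearMap.inr ℝ V V))) ?_
        ((EventuallyEq.refl _ (fun u' => e (φ (u', 0)))).prodMk (deriv_slice_eventuallyEq he φ hu))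
      exact ContDiffAt.prodMk (ContDiffAt.comp (f := fun u' : V => (u', (0 : V))) u hd hi)
        (ContDiffAt.clm_comp (f := fun _ => ContinuousLinearMap.inr ℝ V V)
          (ContDiffAt.comp (f := fun u' : V => (u', (0 : V))) u hd' hi) contDiffAt_const)
    have h2 := (contMDiffAt_symm_of_mem_maximalAtlas (n := ∞) (I := 𝓘(ℝ, JetModel V E)) hc
      (c.map_source (mem_chart_source _ _))).comp u h1.contMDiffAt
    refine h2.congr_of_eventuallyEq ?_
    have hcont : Continuous (fun u' : V => φ (u', 0)) :=
      φ.contMDiff.continuous.comp (by fun_prop)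
    filter_upwards [hcont.continuousAt.eventually (e.open_source.mem_nhds hu)] with u' hu'
    exact (c.left_inv hu').symm⟩

theorem prolong_zero_proj (φ : C^∞⟮𝓘(ℝ, V × V), V × V; 𝓘(ℝ, E), M⟯) :
    (prolong φ 0).proj = φ (0, 0) := rfl

theorem fderiv_prolong (x : Jet 1 V E M) (φ : C^∞⟮𝓘(ℝ, V × V), V × V; 𝓘(ℝ, E), M⟯)
    (h0 : φ (0, 0) ∈ (chartAt E x.proj).source) :
    fderiv ℝ (fun u => chartAt (JetModel V E) x (prolong φ u)) 0 =
      ((fderiv ℝ (fun y => chartAt E x.proj (φ y)) 0).comp (ContinuousLinearMap.inl ℝ V V)).prod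
        (((ContinuousLinearMap.compL ℝ V (V × V) E).flip (ContinuousLinearMap.inr ℝ V V)).comp
          ((fderiv ℝ (fderiv ℝ (fun y => chartAt E x.proj (φ y))) 0).comp
            (ContinuousLinearMap.inl ℝ V V))) := by
  set e := chartAt E x.proj with he'
  have he : e ∈ IsManifold.maximalAtlas 𝓘(ℝ, E) ∞ M := IsManifold.chart_mem_maximalAtlas _
  have hd : ContDiffAt ℝ ∞ (fun y => e (φ y)) ((0 : V), (0 : V)) :=
    contDiffAt_chart_comp he φ.contMDiff.contMDiffAt h0
  have hd' : ContDiffAt ℝ ∞ (fderiv ℝ (fun y => e (φ y))) ((0 : V), (0 : V)) :=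
    hd.fderiv_right (by exact_mod_cast le_rfl)
  have hev : (fun u => chartAt (JetModel V E) x (prolong φ u)) =ᶠ[𝓝 0]
      fun u => (e (φ (u, 0)),
        (fderiv ℝ (fun y => e (φ y)) (u, 0)).comp (ContinuousLinearMap.inr ℝ V V)) :=
    (EventuallyEq.refl _ (fun u' => e (φ (u', 0)))).prodMk (deriv_slice_eventuallyEq he φ h0)
  rw [hev.fderiv_eq]
  have hl := hasFDerivAt_prodMk_left (𝕜 := ℝ) (0 : V) (0 : V)
  have h1 := HasFDerivAt.comp (f := fun u : V => (u, (0 : V))) (0 : V)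
    (hd.differentiableAt (by simp)).hasFDerivAt hl
  have h2 := HasFDerivAt.comp (f := fun u : V => (u, (0 : V))) (0 : V)
    (hd'.differentiableAt (by simp)).hasFDerivAt hl
  have h3 := ((ContinuousLinearMap.compL ℝ V (V × V) E).flip
    (ContinuousLinearMap.inr ℝ V V)).hasFDerivAt.comp (0 : V) h2
  exact (h1.prodMk h3).fderiv

variable (V E M)

/-- The map from the second order jets at the origin of `V × V` to the double jets, which sends
the `2`-jet of `φ` to the `1`-jet of `u ↦ j¹(w ↦ φ (u, w))`. -/
def jetLambda : Jet 2 (V × V) E M → DoubleJet V E M :=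
  Quotient.map (sa := jetSetoid 2 (V × V) E M)
    (sb := jetSetoid 1 V (JetModel V E) (Jet 1 V E M)) prolong (by
    intro φ ξ h
    have h00 : φ (0, 0) = ξ (0, 0) := jetSetoid.apply_zero h
    have hs : φ (0, 0) ∈ (chartAt E (prolong φ 0).proj).source := mem_chart_source E (φ (0, 0))
    have he : chartAt E (prolong φ 0).proj ∈ IsManifold.maximalAtlas 𝓘(ℝ, E) ∞ M :=
      IsManifold.chart_mem_maximalAtlas _
    have hD : ∀ i ≤ 2, _ := fun i hi => jetSetoid.iteratedFDeriv_eq (i := i) he h hs hi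
    have h1 := fderiv_eq_of_iteratedFDeriv_one (hD 1 (by norm_num))
    have h2 := fderiv_fderiv_eq_of_iteratedFDeriv_two (hD 2 le_rfl)
    have h0 : prolong φ 0 = prolong ξ 0 := by
      refine Jet.ext_chart he hs h00 ?_
      exact (deriv_slice_eventuallyEq he φ hs).eq_of_nhds.trans ((congrArg (fun T =>
        T.comp (ContinuousLinearMap.inr ℝ V V)) h1).trans
        (deriv_slice_eventuallyEq he ξ (h00 ▸ hs)).eq_of_nhds.symm)
    refine jetSetoid.of_chart (IsManifold.chart_mem_maximalAtlas (prolong φ 0))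
      (mem_chart_source _ _) h0 ?_
    rw [fderiv_prolong _ φ hs, fderiv_prolong _ ξ (h00 ▸ hs), h1, h2])

/-- The flip `(u, w) ↦ (w, u)`. -/
def flipMap : C^∞⟮𝓘(ℝ, V × V), V × V; 𝓘(ℝ, V × V), V × V⟯ :=
  ⟨Prod.swap, (contDiff_snd.prodMk contDiff_fst).contMDiff⟩

/-- The involution `j²φ ↦ j²(φ ∘ flip)` of the second order jets. -/
def jetFlip : Jet 2 (V × V) E M → Jet 2 (V × V) E M :=
  Quotient.map (sa := jetSetoid 2 (V × V) E M) (sb := jetSetoid 2 (V × V) E M)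
    (fun φ => φ.comp (flipMap V)) (by
    intro φ ξ h f i hi
    have key : ∀ ψ : C^∞⟮𝓘(ℝ, V × V), V × V; 𝓘(ℝ, E), M⟯,
        iteratedFDeriv ℝ i (fun u => f (ψ (flipMap V u))) 0 =
          (iteratedFDeriv ℝ i (fun u => f (ψ u)) 0).compContinuousLinearMap
            fun _ => (ContinuousLinearEquiv.prodComm ℝ V V : V × V →L[ℝ] V × V) := by
      intro ψ
      have hψ : ContDiff ℝ ∞ (fun u => f (ψ u)) := (f.contMDiff.comp ψ.contMDiff).contDiff
      exact ContinuousLinearMap.iteratedFDeriv_comp_right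
        (ContinuousLinearEquiv.prodComm ℝ V V : V × V →L[ℝ] V × V) hψ 0
        (by exact_mod_cast le_top)
    exact (key φ).trans ((congrArg (fun T => T.compContinuousLinearMap fun _ =>
      (ContinuousLinearEquiv.prodComm ℝ V V : V × V →L[ℝ] V × V)) (h f i hi)).trans (key ξ).symm))

end DoubleJets

/-- The Euclidean space of dimension `p`, the source of the jets. -/
abbrev RR (p : ℕ) : Type := EuclideanSpace ℝ (Fin p)

end

/-! A chart of `M` gives a double jet coordinates `(x, X; Y, Z)`. For the image under `jetLambda` of
a map `φ(u, w)`, these are the value of `φ` and its derivatives `∂_w`, `∂_u`, `∂_u∂_w` at the origin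
(`chartAt_jetLambda_mk`). Exchanging `u` and `w` swaps `X` and `Y` and, by symmetry of second
derivatives, transposes `Z` (`chartAt_jetLambda_jetFlip`). The pure second derivatives are lost, so
`jetLambda` need not be injective. However, the new coordinates depend on the old ones only, so the
flip descends to the image of `jetLambda`. That image is everything, because `x + Xw + Yu + Z(u, w)`
realizes any coordinates (`jetLambda_surjective`). Hence the involution exists and is unique.

The formula `(x, X; Y, Z) ↦ (x, Y; X, Zᵗ)` then yields the rest: it squares to the identity, is
smooth, exchanges the two projections `(x, X)` and `(x, Y)`, and acts on fibres by the linear map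
`(Y, Z) ↦ (Y, Zᵗ)`. The primary structure is a smooth vector bundle because every `1`-jet bundle is
one; local triviality of the secondary structure is carried over along the involution. -/

noncomputable section

/-! ### The bundle of `1`-jets -/

section JetBundle

variable {V : Type*} [NormedAddCommGroup V] [NormedSpace ℝ V] [FiniteDimensional ℝ V]
  {E : Type*} [NormedAddCommGroup E] [NormedSpace ℝ E] [FiniteDimensional ℝ E]
  {M : Type*} [TopologicalSpace M] [T2Space M] [ChartedSpace E M] [IsManifold 𝓘(ℝ, E) ∞ M]

/-- The change of charts for the derivative of a `1`-jet. -/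
theorem Jet.deriv_eq_fderiv_comp_deriv {e e' : OpenPartialHomeomorph M E}
    (he : e ∈ IsManifold.maximalAtlas 𝓘(ℝ, E) ∞ M)
    (he' : e' ∈ IsManifold.maximalAtlas 𝓘(ℝ, E) ∞ M) {j : Jet 1 V E M}
    (hj : j.proj ∈ e.source) (hj' : j.proj ∈ e'.source) :
    j.deriv e' = (fderiv ℝ (fun y => e' (e.symm y)) (e j.proj)).comp (j.deriv e) := by
  have hz : (e j.proj, j.deriv e).1 ∈ e.target := e.map_source hj
  have hs : e.symm (e j.proj, j.deriv e).1 ∈ e'.source := by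
    change e.symm (e j.proj) ∈ e'.source
    rwa [e.left_inv hj]
  -- The affine representative of `j` in `e` reduces the chain rule to the derivative of the
  -- transition map.
  have h : Jet.mk (affineGerm e he (e j.proj, j.deriv e)) = j := (jetChart e he).left_inv hj
  conv_lhs => rw [← h]
  rw [Jet.deriv_mk he' (by rw [affineGerm_zero he hz]; exact hs), fderiv_affineGerm he he' hz hs]

variable (V E) in
/-- The local trivialization of the bundle of `1`-jets given by the preferred chart at `b`. -/
def jetTrivialization (b : M) :
    Bundle.Trivialization (V →L[ℝ] E) (jetBundle V E M).proj where
  toOpenPartialHomeomorph :=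
    -- The chart at a jet depends only on its target, so the constant jet at `b` serves to name the
    -- one induced by `chartAt E b`. The inverse chart then returns the first component to `M`.
    (chartAt (JetModel V E) (Jet.mk (ContMDiffMap.const b) : Jet 1 V E M)).trans
      ((chartAt E b).symm.prod (OpenPartialHomeomorph.refl _))
  baseSet := (chartAt E b).source
  open_baseSet := (chartAt E b).open_source
  source_eq := by
    ext j
    constructor
    · exact fun h => h.1
    · exact fun h => ⟨h, (chartAt E b).map_source h, trivial⟩
  target_eq := by
    ext z
    constructor
    · exact fun h => ⟨h.1.1, trivial⟩
    · exact fun h => ⟨⟨h.1, trivial⟩, (chartAt E b).map_source h.1⟩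
  proj_toFun j hj := (chartAt E b).left_inv hj.1

theorem contMDiffOn_jetTrivialization (b : M) :
    ContMDiffOn 𝓘(ℝ, JetModel V E) (𝓘(ℝ, E).prod 𝓘(ℝ, V →L[ℝ] E)) ∞ (jetTrivialization V E b)
      (jetTrivialization V E b).source := by
  rw [(jetTrivialization V E b).source_eq]
  have h1 : ContMDiffOn 𝓘(ℝ, JetModel V E) 𝓘(ℝ, JetModel V E) ∞
      (chartAt (JetModel V E) (Jet.mk (ContMDiffMap.const b) : Jet 1 V E M))
      ((jetBundle V E M).proj ⁻¹' (chartAt E b).source) :=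
    contMDiffOn_of_mem_maximalAtlas (IsManifold.chart_mem_maximalAtlas _)
  refine ContMDiffOn.prodMk ?_ (contDiff_snd.contMDiff.comp_contMDiffOn h1)
  exact Jet.contMDiff_proj.contMDiffOn.congr fun j hj => (chartAt E b).left_inv hj

theorem contMDiffOn_jetTrivialization_symm (b : M) :
    ContMDiffOn (𝓘(ℝ, E).prod 𝓘(ℝ, V →L[ℝ] E)) 𝓘(ℝ, JetModel V E) ∞
      (jetTrivialization V E b).toOpenPartialHomeomorph.symm (jetTrivialization V E b).target := by
  rw [(jetTrivialization V E b).target_eq]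
  have h1 : ContMDiffOn 𝓘(ℝ, JetModel V E) 𝓘(ℝ, JetModel V E) ∞
      (chartAt (JetModel V E) (Jet.mk (ContMDiffMap.const b) : Jet 1 V E M)).symm
      {z | z.1 ∈ (chartAt E b).target} :=
    contMDiffOn_symm_of_mem_maximalAtlas (IsManifold.chart_mem_maximalAtlas _)
  have h2 : ContMDiffOn (𝓘(ℝ, E).prod 𝓘(ℝ, V →L[ℝ] E)) 𝓘(ℝ, JetModel V E) ∞
      (fun z : M × (V →L[ℝ] E) => (chartAt E b z.1, z.2)) ((chartAt E b).source ×ˢ univ) :=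
    ((contMDiffOn_of_mem_maximalAtlas (IsManifold.chart_mem_maximalAtlas b)).comp
      contMDiff_fst.contMDiffOn fun z hz => hz.1).prodMk_space contMDiff_snd.contMDiffOn
  exact h1.comp h2 fun z hz => (chartAt E b).map_source hz.1

variable (V E M) in
/-- The `1`-jets form a smooth vector bundle. -/
theorem isSmoothVectorBundle_jetBundle :
    (jetBundle V E M).IsSmoothVectorBundle (EB := E) (ET := JetModel V E) (V →L[ℝ] E) := by
  intro b
  refine ⟨jetTrivialization V E b, mem_chart_source E b, contMDiffOn_jetTrivialization b,
    contMDiffOn_jetTrivialization_symm b, fun b' hb' => ?_⟩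
  -- The fibre operations at `b'` come from the chart at `b'`, the trivialization from the chart at
  -- `b`. They differ by composition with the derivative of the transition map, which is constant
  -- along the fibre.
  let A : (V →L[ℝ] E) →L[ℝ] (V →L[ℝ] E) := ContinuousLinearMap.compL ℝ V E E
    (fderiv ℝ (fun y => chartAt E b ((chartAt E b').symm y)) (chartAt E b' b'))
  let L : (jetBundle V E M).Fibre b' ≃ₗ[ℝ] (V →L[ℝ] E) :=
    letI := (jetFibreEquiv (E := E) V b').addCommGroup
    letI := (jetFibreEquiv (E := E) V b').module ℝ
    (jetFibreEquiv (E := E) V b').linearEquiv ℝ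
  have h : (fun v : (jetBundle V E M).Fibre b' => (jetTrivialization V E b v.1).2) =
      A.toLinearMap ∘ₗ L.toLinearMap := by
    funext ⟨j, hj⟩
    change j.proj = b' at hj
    subst hj
    exact Jet.deriv_eq_fderiv_comp_deriv (IsManifold.chart_mem_maximalAtlas _)
      (IsManifold.chart_mem_maximalAtlas _) (mem_chart_source E _) hb'
  rw [h]
  exact LinearMap.isLinear _

end JetBundle

/-! ### Transport of vector bundles -/

namespace FibrewiseVectorSpace

variable {EB : Type*} [NormedAddCommGroup EB] [NormedSpace ℝ EB]
  {B : Type*} [TopologicalSpace B] [ChartedSpace EB B]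
  {ET : Type*} [NormedAddCommGroup ET] [NormedSpace ℝ ET]
  {T : Type*} [TopologicalSpace T] [ChartedSpace ET T]
  {ET' : Type*} [NormedAddCommGroup ET'] [NormedSpace ℝ ET']
  {T' : Type*} [TopologicalSpace T'] [ChartedSpace ET' T']
  {F : Type*} [NormedAddCommGroup F] [NormedSpace ℝ F]
  {F' : Type*} [NormedAddCommGroup F'] [NormedSpace ℝ F']

/-- A structure isomorphic to a smooth vector bundle is a smooth vector bundle. -/
theorem IsSmoothVectorBundle.of_isIso {S : FibrewiseVectorSpace T B}
    {S' : FibrewiseVectorSpace T' B} {l : T → T'}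
    (hS : S.IsSmoothVectorBundle (EB := EB) (ET := ET) F)
    (hl : S.IsIso (ET := ET) (ET' := ET') S' l) (A : F ≃L[ℝ] F') :
    S'.IsSmoothVectorBundle (EB := EB) (ET := ET') F' := by
  obtain ⟨d, rfl⟩ := hl.diffeomorph
  have hproj : ∀ v, S.proj (d.symm v) = S'.proj v := fun v => by
    rw [← hl.proj_comp, d.apply_symm_apply]
  intro b
  obtain ⟨e, hb, h1, h2, h3⟩ := hS b
  -- A trivialization of `S` is read through the inverse of `d`, and its fibre component is then
  -- moved by `A`.
  let e' : Bundle.Trivialization F' S'.proj :=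
    { toOpenPartialHomeomorph := (d.symm.toHomeomorph.toOpenPartialHomeomorph.trans
        e.toOpenPartialHomeomorph).trans
          ((OpenPartialHomeomorph.refl B).prod A.toHomeomorph.toOpenPartialHomeomorph)
      baseSet := e.baseSet
      open_baseSet := e.open_baseSet
      source_eq := by
        ext v
        refine Iff.trans (b := d.symm v ∈ e.source) ?_ ?_
        · exact ⟨fun h => h.1.2, fun h => ⟨⟨trivial, h⟩, trivial, trivial⟩⟩
        · rw [e.mem_source, hproj, mem_preimage]
      target_eq := by
        ext z
        refine Iff.trans (b := (z.1, A.symm z.2) ∈ e.target) ?_ ?_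
        · exact ⟨fun h => h.2.1, fun h => ⟨⟨trivial, trivial⟩, h, trivial⟩⟩
        · rw [e.mem_target]
          exact ⟨fun h => ⟨h, trivial⟩, fun h => h.1⟩
      proj_toFun := fun v hv => (e.proj_toFun _ hv.1.2).trans (hproj v) }
  have he' : ∀ v, e' v = ((e (d.symm v)).1, A (e (d.symm v)).2) := fun _ => rfl
  have he's : ∀ z, e'.toOpenPartialHomeomorph.symm z =
    d (e.toOpenPartialHomeomorph.symm (z.1, A.symm z.2)) := fun _ => rfl
  refine ⟨e', hb, ?_, ?_, fun b' hb' => ?_⟩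
  · have h : ContMDiffOn 𝓘(ℝ, ET') (𝓘(ℝ, EB).prod 𝓘(ℝ, F)) ∞ (fun v => e (d.symm v)) e'.source :=
      h1.comp d.symm.contMDiff.contMDiffOn fun v hv => hv.1.2
    exact (contMDiff_fst.comp_contMDiffOn h).prodMk
      (A.contDiff.contMDiff.comp_contMDiffOn (contMDiff_snd.comp_contMDiffOn h))
  · refine d.contMDiff.comp_contMDiffOn (h2.comp (contMDiff_fst.contMDiffOn.prodMk
      (A.symm.contDiff.contMDiff.comp_contMDiffOn contMDiff_snd.contMDiffOn)) fun z hz => hz.2.1)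
  -- `IsIso` gives linearity of `d` only, while `e'` involves its inverse; linearity of the latter
  -- comes from inverting a bijective linear map.
  · let L : S.Fibre b' →ₗ[ℝ] S'.Fibre b' := (hl.linear b').mk' _
    have hL : Function.Bijective L := by
      constructor
      · intro v w h
        exact Subtype.ext (d.injective (congrArg Subtype.val h))
      · intro v
        exact ⟨⟨d.symm v.1, (hproj v.1).trans v.2⟩, Subtype.ext (d.apply_symm_apply v.1)⟩
    have h : (fun v : S'.Fibre b' => (e' v.1).2) = A.toLinearMap ∘ₗ ((h3 b' hb').mk' _) ∘ₗ
        (LinearEquiv.ofBijective L hL).symm.toLinearMap := by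
      funext v
      obtain ⟨w, rfl⟩ := (LinearEquiv.ofBijective L hL).surjective v
      simp only [LinearMap.coe_comp, Function.comp_apply, LinearEquiv.coe_coe,
        LinearEquiv.symm_apply_apply]
      change A (e (d.symm (d w.1))).2 = A (e w.1).2
      rw [d.symm_apply_apply]
    rw [h]
    exact LinearMap.isLinear _

end FibrewiseVectorSpace

/-! ### The canonical involution -/

section CanonicalInvolution

variable {V : Type*} [NormedAddCommGroup V] [NormedSpace ℝ V] [FiniteDimensional ℝ V]
  {E : Type*} [NormedAddCommGroup E] [NormedSpace ℝ E] [FiniteDimensional ℝ E]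
  {M : Type*} [TopologicalSpace M] [T2Space M] [ChartedSpace E M] [IsManifold 𝓘(ℝ, E) ∞ M]

/-! ### Coordinates of double jets and the effect of the flip. -/

variable (V E) in
/-- The canonical involution in a chart: `(x, X; Y, Z) ↦ (x, Y; X, Zᵗ)`. -/
def doubleFlip : JetModel V (JetModel V E) →L[ℝ] JetModel V (JetModel V E) where
  toFun z := ((z.1.1, (ContinuousLinearMap.fst ℝ E (V →L[ℝ] E)).comp z.2),
    z.1.2.prod ((ContinuousLinearMap.snd ℝ E (V →L[ℝ] E)).comp z.2).flip)
  map_add' z z' := by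
    refine Prod.ext (Prod.ext rfl ?_) ?_ <;> ext <;> simp
  map_smul' r z := by
    refine Prod.ext (Prod.ext rfl ?_) ?_ <;> ext <;> simp
  cont := by
    have h : Continuous fun z : JetModel V (JetModel V E) =>
        ((ContinuousLinearMap.snd ℝ E (V →L[ℝ] E)).comp z.2).flip :=
      (ContinuousLinearMap.flipₗᵢ ℝ V V E).continuous.comp
        (continuous_const.clm_comp continuous_snd)
    have h' : Continuous fun z : JetModel V (JetModel V E) =>
        z.1.2.prod ((ContinuousLinearMap.snd ℝ E (V →L[ℝ] E)).comp z.2).flip :=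
      (ContinuousLinearMap.prodₗᵢ (𝕜 := ℝ) (E := V) (F := E) (G := V →L[ℝ] E) ℝ).continuous.comp (continuous_fst.snd.prodMk h)
    exact (continuous_fst.fst.prodMk (continuous_const.clm_comp continuous_snd)).prodMk h'

theorem doubleFlip_doubleFlip (z : JetModel V (JetModel V E)) :
    doubleFlip V E (doubleFlip V E z) = z := rfl

/-- The double jet of `φ` in the chart induced by a chart of `M`. -/
theorem chartAt_jetLambda_mk (j : DoubleJet V E M)
    (φ : C^∞⟮𝓘(ℝ, V × V), V × V; 𝓘(ℝ, E), M⟯)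
    (h0 : φ (0, 0) ∈ (chartAt E j.proj.proj).source) :
    chartAt (JetModel V (JetModel V E)) j (jetLambda V E M (Jet.mk φ)) =
      ((chartAt E j.proj.proj (φ (0, 0)),
        (fderiv ℝ (fun y => chartAt E j.proj.proj (φ y)) 0).comp
          (ContinuousLinearMap.inr ℝ V V)),
        ((fderiv ℝ (fun y => chartAt E j.proj.proj (φ y)) 0).comp
          (ContinuousLinearMap.inl ℝ V V)).prod
        (((ContinuousLinearMap.compL ℝ V (V × V) E).flip (ContinuousLinearMap.inr ℝ V V)).comp
          ((fderiv ℝ (fderiv ℝ (fun y => chartAt E j.proj.proj (φ y))) 0).comp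
            (ContinuousLinearMap.inl ℝ V V)))) := by
  -- The last slot is `v ↦ (w ↦ D²f (v, 0) (0, w))`, with `f` the map `φ` read in the chart: only
  -- the mixed block of the second derivative survives.
  refine Prod.ext (Prod.ext rfl ?_) ?_
  · exact (deriv_slice_eventuallyEq (IsManifold.chart_mem_maximalAtlas j.proj.proj) φ h0).eq_of_nhds
  · exact (Jet.deriv_mk (IsManifold.chart_mem_maximalAtlas j.proj) h0).trans
      (fderiv_prolong j.proj φ h0)

/-- The swap is an invertible linear map, so `f` need not be differentiable. The identity thus holds
at every point, even where a chart expression is meaningless, and can be differentiated again. -/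
theorem fderiv_comp_prodComm {F : Type*} [NormedAddCommGroup F] [NormedSpace ℝ F]
    (f : V × V → F) (x : V × V) :
    fderiv ℝ (fun y => f y.swap) x =
      (fderiv ℝ f x.swap).comp (ContinuousLinearEquiv.prodComm ℝ V V : V × V →L[ℝ] V × V) :=
  (ContinuousLinearEquiv.prodComm ℝ V V).comp_right_fderiv (f := f) (x := x)

/-- Swapping the variables exchanges the two first partial derivatives and reverses the order of the
mixed one, which symmetry of the second derivative turns into a transpose. The right-hand side sees
`a` only through `jetLambda V E M a`; this makes the involution well defined. -/
theorem chartAt_jetLambda_jetFlip (j : DoubleJet V E M) (a : Jet 2 (V × V) E M)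
    (h0 : a.proj ∈ (chartAt E j.proj.proj).source) :
    chartAt (JetModel V (JetModel V E)) j (jetLambda V E M (jetFlip V E M a)) =
      doubleFlip V E (chartAt (JetModel V (JetModel V E)) j (jetLambda V E M a)) := by
  obtain ⟨φ, rfl⟩ : ∃ φ, Jet.mk φ = a := ⟨_, a.mk_rep⟩
  have hs : φ (0, 0) ∈ (chartAt E j.proj.proj).source := h0
  have hflip : jetFlip V E M (Jet.mk φ) = Jet.mk (φ.comp (flipMap V)) := rfl
  rw [hflip, chartAt_jetLambda_mk j _ (by exact hs), chartAt_jetLambda_mk j φ hs]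
  set f : V × V → E := fun y => chartAt E j.proj.proj (φ y) with hf
  have hc : (fun y => chartAt E j.proj.proj ((φ.comp (flipMap V)) y)) = fun y => f y.swap := rfl
  have hfd : ContDiffAt ℝ ∞ f (0, 0) :=
    contDiffAt_chart_comp (IsManifold.chart_mem_maximalAtlas _) φ.contMDiff.contMDiffAt hs
  have hd' : DifferentiableAt ℝ (fderiv ℝ f) (0, 0) :=
    (hfd.fderiv_right (m := ∞) (by exact_mod_cast le_rfl)).differentiableAt (by simp)
  have hsymm : IsSymmSndFDerivAt ℝ f 0 := hfd.isSymmSndFDerivAt (by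
    rw [minSmoothness_of_isRCLikeNormedField]
    exact WithTop.coe_le_coe.2 (le_top : (2 : ℕ∞) ≤ ⊤))
  have h1 : fderiv ℝ (fun y => f y.swap) = fun x => (fderiv ℝ f x.swap).comp
      (ContinuousLinearEquiv.prodComm ℝ V V : V × V →L[ℝ] V × V) :=
    funext fun x => fderiv_comp_prodComm f x
  have h2 : ∀ v w : V × V, fderiv ℝ (fderiv ℝ (fun y : V × V => f y.swap)) 0 v w =
      fderiv ℝ (fderiv ℝ f) 0 v.swap w.swap := by
    intro v w
    have hg : HasFDerivAt (fun x : V × V => fderiv ℝ f x.swap)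
        ((fderiv ℝ (fderiv ℝ f) 0).comp
          (ContinuousLinearEquiv.prodComm ℝ V V : V × V →L[ℝ] V × V)) 0 :=
      HasFDerivAt.comp (g := fderiv ℝ f) (0 : V × V) hd'.hasFDerivAt
        (ContinuousLinearEquiv.prodComm ℝ V V : V × V →L[ℝ] V × V).hasFDerivAt
    rw [h1, (hg.clm_comp (hasFDerivAt_const _ _)).fderiv]
    simp
  rw [hc]
  refine Prod.ext (Prod.ext rfl ?_) ?_
  · rw [h1]
    ext v
    simp [doubleFlip]
  · rw [h1]
    refine ContinuousLinearMap.ext fun v => Prod.ext ?_ (ContinuousLinearMap.ext fun w => ?_)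
    · simp [doubleFlip]
    · rw [← h1]
      -- The swap produces `D²f (0, v) (w, 0)`, and symmetry makes it `D²f (w, 0) (0, v)`, the
      -- transposed mixed block.
      have h3 := h2 (v, 0) (0, w)
      have h4 := hsymm (0, v) (w, 0)
      simpa [doubleFlip] using h3.trans h4

theorem proj_proj_jetLambda (a : Jet 2 (V × V) E M) : (jetLambda V E M a).proj.proj = a.proj := by
  obtain ⟨φ, rfl⟩ : ∃ φ, Jet.mk φ = a := ⟨_, a.mk_rep⟩
  rfl

theorem proj_jetFlip (a : Jet 2 (V × V) E M) : (jetFlip V E M a).proj = a.proj := by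
  obtain ⟨φ, rfl⟩ : ∃ φ, Jet.mk φ = a := ⟨_, a.mk_rep⟩
  rfl

/-- Chart domains of double jets are determined by the target in `M`. The involution fixes that
target, hence preserves each of these domains. -/
theorem mem_doubleChartAt_source {j j' : DoubleJet V E M} :
    j' ∈ (chartAt (JetModel V (JetModel V E)) j).source ↔
      j'.proj.proj ∈ (chartAt E j.proj.proj).source := Iff.rfl

-- A polynomial of degree at most one in each variable has arbitrary value, first partial
-- derivatives and mixed derivative at the origin. No symmetry of `Z` is required, since its two
-- arguments come from different variables.
variable (V E M) in
theorem jetLambda_surjective : Function.Surjective (jetLambda V E M) := by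
  intro j
  set e := chartAt E j.proj.proj with he'
  have he : e ∈ IsManifold.maximalAtlas 𝓘(ℝ, E) ∞ M := IsManifold.chart_mem_maximalAtlas _
  set z := chartAt (JetModel V (JetModel V E)) j j with hz
  set Z : V →L[ℝ] V →L[ℝ] E := (ContinuousLinearMap.snd ℝ E (V →L[ℝ] E)).comp z.2 with hZ
  set Y : V →L[ℝ] E := (ContinuousLinearMap.fst ℝ E (V →L[ℝ] E)).comp z.2 with hY
  have hzt : z.1.1 ∈ e.target := e.map_source (mem_chart_source E _)
  let g : V × V → E := fun y => z.1.1 + (z.1.2 y.2 + Y y.1 + Z y.1 y.2)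
  have hg : ContDiff ℝ ∞ g := by
    have : ContDiff ℝ ∞ fun y : V × V => Z y.1 y.2 :=
      (Z.contDiff.comp contDiff_fst).clm_apply contDiff_snd
    exact contDiff_const.add (((z.1.2.contDiff.comp contDiff_snd).add
      (Y.contDiff.comp contDiff_fst)).add this)
  have hg0 : g 0 = z.1.1 := by simp [g]
  have hg1 : fderiv ℝ g = fun x => z.1.2.comp (ContinuousLinearMap.snd ℝ V V) +
      Y.comp (ContinuousLinearMap.fst ℝ V V) +
      ((Z x.1).comp (ContinuousLinearMap.snd ℝ V V) +
        (Z.flip x.2).comp (ContinuousLinearMap.fst ℝ V V)) := by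
    funext x
    have hb : HasFDerivAt (fun y : V × V => Z y.1 y.2)
        ((Z x.1).comp (ContinuousLinearMap.snd ℝ V V) +
          (Z.flip x.2).comp (ContinuousLinearMap.fst ℝ V V)) x := by
      refine ((Z.hasFDerivAt.comp x hasFDerivAt_fst).clm_apply hasFDerivAt_snd).congr_fderiv ?_
      ext v <;> simp
    exact ((((z.1.2.comp (ContinuousLinearMap.snd ℝ V V)).hasFDerivAt.add
      (Y.comp (ContinuousLinearMap.fst ℝ V V)).hasFDerivAt).add hb).const_add z.1.1).fderiv
  have hg2 : ∀ v w, fderiv ℝ (fderiv ℝ g) 0 v w = Z v.1 w.2 + Z w.1 v.2 := by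
    intro v w
    -- Both nonconstant terms of `hg1` are linear in `x`; written as compositions of continuous
    -- linear maps, they are their own derivatives.
    have h1 : HasFDerivAt (fun x : V × V => (Z x.1).comp (ContinuousLinearMap.snd ℝ V V))
        ((((ContinuousLinearMap.compL ℝ (V × V) V E).flip (ContinuousLinearMap.snd ℝ V V)).comp
          Z).comp (ContinuousLinearMap.fst ℝ V V)) 0 :=
      (((ContinuousLinearMap.compL ℝ (V × V) V E).flip (ContinuousLinearMap.snd ℝ V V) ∘L Z) ∘L
        ContinuousLinearMap.fst ℝ V V).hasFDerivAt
    have h2 : HasFDerivAt (fun x : V × V => (Z.flip x.2).comp (ContinuousLinearMap.fst ℝ V V))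
        ((((ContinuousLinearMap.compL ℝ (V × V) V E).flip (ContinuousLinearMap.fst ℝ V V)).comp
          Z.flip).comp (ContinuousLinearMap.snd ℝ V V)) 0 :=
      (((ContinuousLinearMap.compL ℝ (V × V) V E).flip (ContinuousLinearMap.fst ℝ V V) ∘L Z.flip) ∘L
        ContinuousLinearMap.snd ℝ V V).hasFDerivAt
    rw [hg1, ((h1.fun_add h2).const_add _).fderiv]
    simp
  -- `g` may leave the chart target away from the origin, so only its germ is lifted to `M`.
  obtain ⟨φ, hφ⟩ := exists_smooth_germ (V := V × V) he hg (by rw [hg0]; exact hzt)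
  have hφ0 : φ (0, 0) = j.proj.proj := by
    refine hφ.self_of_nhds.trans ?_
    rw [hg0]
    exact e.left_inv (mem_chart_source E _)
  have hs : φ (0, 0) ∈ e.source := hφ0 ▸ mem_chart_source E _
  have hev : (fun y => e (φ y)) =ᶠ[𝓝 0] g := by
    filter_upwards [hφ, hg.continuous.continuousAt.eventually
      (e.open_target.mem_nhds (by rw [hg0]; exact hzt))] with y hy hy'
    rw [hy, e.right_inv hy']
  refine ⟨Jet.mk φ, (chartAt (JetModel V (JetModel V E)) j).injOn
    (mem_doubleChartAt_source.2 (by rwa [proj_proj_jetLambda])) (mem_chart_source _ j) ?_⟩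
  rw [chartAt_jetLambda_mk j φ hs, ← hz, ← he', hev.fderiv_eq, hev.fderiv.fderiv_eq]
  refine Prod.ext (Prod.ext (congrArg e hφ0) ?_) ?_
  · rw [hg1]
    ext v
    simp
  · refine ContinuousLinearMap.ext fun v => Prod.ext ?_ (ContinuousLinearMap.ext fun w => ?_)
    · rw [hg1]
      simp [hY]
    -- On these vectors the second term of `hg2` vanishes and `Z v w` remains.
    · have := hg2 (v, 0) (0, w)
      simpa [hZ] using this

/-! ### The involution and its coordinate expression. -/

variable (V E M) in
/-- The canonical involution of the double jets. -/
def canonicalInvolution (j : DoubleJet V E M) : DoubleJet V E M :=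
  -- The choice of the preimage is immaterial, by `canonicalInvolution_jetLambda`.
  jetLambda V E M (jetFlip V E M (jetLambda_surjective V E M j).choose)

theorem proj_proj_canonicalInvolution (j : DoubleJet V E M) :
    (canonicalInvolution V E M j).proj.proj = j.proj.proj := by
  rw [canonicalInvolution, proj_proj_jetLambda, proj_jetFlip, ← proj_proj_jetLambda,
    (jetLambda_surjective V E M j).choose_spec]

theorem chartAt_canonicalInvolution (j j' : DoubleJet V E M)
    (h : j'.proj.proj ∈ (chartAt E j.proj.proj).source) :
    chartAt (JetModel V (JetModel V E)) j (canonicalInvolution V E M j') =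
      doubleFlip V E (chartAt (JetModel V (JetModel V E)) j j') := by
  have hs := (jetLambda_surjective V E M j').choose_spec
  rw [canonicalInvolution, chartAt_jetLambda_jetFlip, hs]
  rwa [← proj_proj_jetLambda, hs]

/-- The chosen preimage of `jetLambda V E M a` may differ from `a`, but both sides have the same
coordinates in one chart, namely the `doubleFlip` of those of `jetLambda V E M a`. -/
theorem canonicalInvolution_jetLambda (a : Jet 2 (V × V) E M) :
    canonicalInvolution V E M (jetLambda V E M a) = jetLambda V E M (jetFlip V E M a) := by
  set j := jetLambda V E M a with hj
  have hp : a.proj ∈ (chartAt E j.proj.proj).source := by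
    rw [hj, proj_proj_jetLambda]
    exact mem_chart_source E _
  refine (chartAt (JetModel V (JetModel V E)) j).injOn ?_ ?_ ?_
  · rw [mem_doubleChartAt_source, proj_proj_canonicalInvolution]
    exact mem_chart_source E _
  · rwa [mem_doubleChartAt_source, proj_proj_jetLambda (jetFlip V E M a), proj_jetFlip]
  · rw [chartAt_canonicalInvolution j j (mem_chart_source E _), chartAt_jetLambda_jetFlip j a hp]

variable (V E M) in
theorem canonicalInvolution_involutive : Function.Involutive (canonicalInvolution V E M) := by
  intro j
  refine (chartAt (JetModel V (JetModel V E)) j).injOn ?_ (mem_chart_source _ j) ?_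
  · rw [mem_doubleChartAt_source, proj_proj_canonicalInvolution, proj_proj_canonicalInvolution]
    exact mem_chart_source E _
  · rw [chartAt_canonicalInvolution, chartAt_canonicalInvolution, doubleFlip_doubleFlip]
    · exact mem_chart_source E _
    · rw [proj_proj_canonicalInvolution]
      exact mem_chart_source E _

-- On the chart domain at `j`, which is preserved, the map is the continuous linear `doubleFlip`
-- conjugated by the chart.
variable (V E M) in
theorem contMDiff_canonicalInvolution :
    ContMDiff 𝓘(ℝ, JetModel V (JetModel V E)) 𝓘(ℝ, JetModel V (JetModel V E)) ∞
      (canonicalInvolution V E M) := by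
  intro j
  set c := chartAt (JetModel V (JetModel V E)) j with hc
  have hcm : c ∈ IsManifold.maximalAtlas 𝓘(ℝ, JetModel V (JetModel V E)) ∞ (DoubleJet V E M) :=
    IsManifold.chart_mem_maximalAtlas j
  have hmem : ∀ j' ∈ c.source, canonicalInvolution V E M j' ∈ c.source := fun j' hj' => by
    rw [hc, mem_doubleChartAt_source, proj_proj_canonicalInvolution]
    exact hj'
  have h1 := (doubleFlip V E).contDiff.contMDiff.contMDiffAt.comp j
    (contMDiffAt_of_mem_maximalAtlas hcm (mem_chart_source _ j))
  have h2 := (contMDiffAt_symm_of_mem_maximalAtlas hcm (x := doubleFlip V E (c j)) (by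
    rw [← chartAt_canonicalInvolution j j (mem_chart_source E _)]
    exact c.map_source (hmem j (mem_chart_source _ j)))).comp j h1
  refine h2.congr_of_eventuallyEq ?_
  filter_upwards [c.open_source.mem_nhds (mem_chart_source _ j)] with j' hj'
  change _ = c.symm (doubleFlip V E (c j'))
  rw [← chartAt_canonicalInvolution j j' hj']
  exact (c.left_inv (hmem j' hj')).symm

/-- The secondary projection reads `(x, Y)` and the primary one `(x, X)`; the involution
interchanges `X` and `Y`. -/
theorem secondaryProj_canonicalInvolution (j : DoubleJet V E M) :
    secondaryProj V E M (canonicalInvolution V E M j) = j.proj := by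
  have hp : (secondaryProj V E M (canonicalInvolution V E M j)).proj = j.proj.proj := by
    rw [proj_secondaryProj, proj_proj_canonicalInvolution]
  refine Jet.ext_chart (IsManifold.chart_mem_maximalAtlas j.proj.proj)
    (by rw [hp]; exact mem_chart_source E _) hp ?_
  rw [deriv_secondaryProj j.proj _ (by
    rw [proj_proj_canonicalInvolution]; exact mem_chart_source E _)]
  have h := chartAt_canonicalInvolution j j (mem_chart_source E _)
  refine (congrArg (fun z => (ContinuousLinearMap.fst ℝ E (V →L[ℝ] E)).comp z.2) h).trans ?_
  rfl

/-! ### Isomorphism of the primary and secondary structures. -/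

variable (V E) in
/-- The typical fibre of the primary structure is isomorphic to that of the secondary structure. -/
def typicalFibreEquiv :
    (V →L[ℝ] JetModel V E) ≃L[ℝ] (V →L[ℝ] E) × (V →L[ℝ] (V →L[ℝ] E)) :=
  (ContinuousLinearMap.prodₗᵢ (𝕜 := ℝ) (E := V) (F := E) (G := V →L[ℝ] E) ℝ).symm.toContinuousLinearEquiv

variable (V E M) in
theorem isIso_canonicalInvolution :
    (primaryBundle V E M).IsIso (ET := JetModel V (JetModel V E))
      (ET' := JetModel V (JetModel V E)) (secondaryBundle V E M)
      (canonicalInvolution V E M) where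
  proj_comp := secondaryProj_canonicalInvolution
  diffeomorph := ⟨{
    toEquiv := (canonicalInvolution_involutive V E M).toPerm
    contMDiff_toFun := contMDiff_canonicalInvolution V E M
    contMDiff_invFun := contMDiff_canonicalInvolution V E M }, rfl⟩
  linear θ := by
    let L : (primaryBundle V E M).Fibre θ ≃ₗ[ℝ] (V →L[ℝ] JetModel V E) :=
      letI := (jetFibreEquiv (E := JetModel V E) V θ).addCommGroup
      letI := (jetFibreEquiv (E := JetModel V E) V θ).module ℝ
      (jetFibreEquiv (E := JetModel V E) V θ).linearEquiv ℝ
    let L' : (secondaryBundle V E M).Fibre θ ≃ₗ[ℝ] (V →L[ℝ] E) × (V →L[ℝ] (V →L[ℝ] E)) :=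
      letI := (secondaryFibreEquiv V E M θ).addCommGroup
      letI := (secondaryFibreEquiv V E M θ).module ℝ
      (secondaryFibreEquiv V E M θ).linearEquiv ℝ
    -- Both fibres over `θ` are identified with their models by the same chart at `θ`, so no change
    -- of charts enters: the involution is `(Y, Z) ↦ (Y, Zᵗ)`.
    let A : ((V →L[ℝ] E) × (V →L[ℝ] (V →L[ℝ] E))) →ₗ[ℝ]
        (V →L[ℝ] E) × (V →L[ℝ] (V →L[ℝ] E)) :=
      LinearMap.prodMap LinearMap.id (ContinuousLinearMap.flipₗᵢ ℝ V V E).toLinearEquiv.toLinearMap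
    have h : (fun v : (primaryBundle V E M).Fibre θ => (⟨canonicalInvolution V E M v.1,
        (secondaryProj_canonicalInvolution v.1).trans v.2⟩ : (secondaryBundle V E M).Fibre θ)) =
        L'.symm.toLinearMap ∘ₗ A ∘ₗ (typicalFibreEquiv V E).toLinearMap ∘ₗ L.toLinearMap := by
      funext ⟨j, hj⟩
      change j.proj = θ at hj
      subst hj
      refine L'.injective ?_
      refine Eq.trans ?_ (L'.apply_symm_apply _).symm
      have h := chartAt_canonicalInvolution j j (mem_chart_source E _)
      refine (congrArg (fun z : JetModel V (JetModel V E) =>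
        (z.1.2, (ContinuousLinearMap.snd ℝ E (V →L[ℝ] E)).comp z.2)) h).trans ?_
      exact Prod.ext rfl rfl
    rw [h]
    exact LinearMap.isLinear _

end CanonicalInvolution

end

theorem proposition5 (p : ℕ) {E : Type*} [NormedAddCommGroup E] [NormedSpace ℝ E]
    [FiniteDimensional ℝ E] {M : Type*} [TopologicalSpace M] [T2Space M] [ChartedSpace E M]
    [IsManifold 𝓘(ℝ, E) ∞ M] :
    (primaryBundle (RR p) E M).IsSmoothVectorBundle
        (EB := JetModel (RR p) E) (ET := JetModel (RR p) (JetModel (RR p) E))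
        (RR p →L[ℝ] JetModel (RR p) E) ∧
      (secondaryBundle (RR p) E M).IsSmoothVectorBundle
        (EB := JetModel (RR p) E) (ET := JetModel (RR p) (JetModel (RR p) E))
        ((RR p →L[ℝ] E) × (RR p →L[ℝ] (RR p →L[ℝ] E))) ∧
      ∃ ℓ : DoubleJet (RR p) E M → DoubleJet (RR p) E M,
        (∀ j, ℓ (jetLambda (RR p) E M j) = jetLambda (RR p) E M (jetFlip (RR p) E M j)) ∧
        (∀ ℓ' : DoubleJet (RR p) E M → DoubleJet (RR p) E M,
          (∀ j, ℓ' (jetLambda (RR p) E M j) = jetLambda (RR p) E M (jetFlip (RR p) E M j)) →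
            ℓ' = ℓ) ∧
        Function.Involutive ℓ ∧
        (primaryBundle (RR p) E M).IsIso
          (ET := JetModel (RR p) (JetModel (RR p) E))
          (ET' := JetModel (RR p) (JetModel (RR p) E))
          (secondaryBundle (RR p) E M) ℓ :=
  ⟨isSmoothVectorBundle_jetBundle _ _ _,
    (isSmoothVectorBundle_jetBundle _ _ _).of_isIso (isIso_canonicalInvolution (RR p) E M)
      (typicalFibreEquiv (RR p) E),
    canonicalInvolution (RR p) E M, canonicalInvolution_jetLambda, fun ℓ' hℓ' => funext fun j => by
      obtain ⟨a, rfl⟩ := jetLambda_surjective (RR p) E M j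
      -- Uniqueness is surjectivity of `jetLambda`.
      rw [hℓ', canonicalInvolution_jetLambda],
    canonicalInvolution_involutive _ _ _, isIso_canonicalInvolution _ _ _⟩
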